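/- Let $\mathcal R$ be an injective von Neumann algebra on a Hilbert space $H$, and let $\alpha=(\alpha_g)_{g\in G}$ be an action of a countable discrete group $G$ on $\mathcal R$ by $*$-automorphisms. Let $\lambda_g\delta_h=\delta_{gh}$ be the left translations on $\ell_2(G)$ and $e_{(g,h)}$ the matrix units of $B(\ell_2(G))$. Put $L_g=I_H\otimes\lambda_g$ and $\Psi(r)=\sum_{g\in G}\alpha_{g^{-1}}(r)\otimes e_{(g,g)}$ for $r\in\mathcal R$, both acting on $H\otimes\ell_2(G)$. Let the crossed product $\mathcal L(\mathcal R,\alpha,G)$ be the ultraweak closure of the linear span of $\{L_g\Psi(r): g\in G,\ r\in\mathcal R\}$. For a bounded operator $x=\sum_{g,h}x_{(g,h)}\otimes e_{(g,h)}$ on $H\otimes\ell_2(G)$ put $\mathrm{Diag}(x)=\sum_g x_{(g,g)}\otimes e_{(g,g)}$. Then there exists an unbounded expectation $(\chi,\sigma)$ of $B(H\otimes\ell_2(G))$ to $\mathcal L(\mathcal R,\alpha,G)$. That is, there exist a function $\chi:G\to\mathbb R$ that is strictly positive ($\chi(g)>0$ for all $g$) and positive definite, and a linear, unital, completely positive map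 $\sigma:B(H\otimes\ell_2(G))\to\mathcal L(\mathcal R,\alpha,G)$ that is $\mathcal R$-bimodular ($\sigma(\Psi(r)x\Psi(s))=\Psi(r)\sigma(x)\Psi(s)$ for all $r,s\in\mathcal R$ and all $x$), such that (i) $\sigma(L_g\Psi(r))=\chi(g)L_g\Psi(r)$ for all $g\in G$ and $r\in\mathcal R$; (ii) $\|\mathrm{Diag}(L_{g^{-1}}\sigma(x))\|\le\chi(g)\|x\|$ for all $x\in B(H\otimes\ell_2(G))$ and $g\in G$. Moreover, the pair can be taken of the following form: there are a completely positive conditional expectation $\pi$ of $B(H)$ onto $\mathcal R$ and a unit vector $\xi=(k_g)_{g\in G}$ in $\ell_2(G)$ with $k_g>0$ for all $g$, such that $\chi(g)=\langle\lambda_g\xi,\xi\rangle$ for all $g$ and $\sigma=\sigma_\xi$, where $$\sigma_\xi(x)=\sum_{g,h\in G}L_{gh^{-1}}\Psi\big(\alpha_h(\pi(x_{(g,h)}))\big)\overline{k_g}\,k_h,$$ the sum converging in norm at each entry of the block matrices. -/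

import Mathlib

open scoped CStarAlgebra ComplexOrder InnerProductSpace ENNReal

noncomputable section

namespace CrossedProduct

universe u v

/-! ### Injective von Neumann algebras -/

/-- Complete positivity of a linear map defined on a subspace `S` of a C*-algebra `A`: every square
matrix with entries in `S` which is positive over `A` is mapped entrywise to a positive matrix. -/
def IsCompletelyPositiveOn {A : Type*} {B : Type*} [CStarAlgebra A] [PartialOrder A]
    [StarOrderedRing A] [CStarAlgebra B] [PartialOrder B] [StarOrderedRing B]
    (S : Submodule ℂ A) (φ : S →ₗ[ℂ] B) : Prop :=
  ∀ (k : ℕ) (M : Fin k → Fin k → S),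
    0 ≤ CStarMatrix.ofMatrix (Matrix.of fun i j => (M i j : A)) →
    0 ≤ CStarMatrix.ofMatrix (Matrix.of fun i j => φ (M i j))

/-- A von Neumann algebra `R` is injective if every completely positive map into `R`, defined on an
operator system `S` (a self-adjoint subspace containing the unit) of a unital C*-algebra `A`, extends
to a completely positive map from `A` into `R`. -/
def IsInjective {H : Type u} [NormedAddCommGroup H] [InnerProductSpace ℂ H] [CompleteSpace H]
    (R : VonNeumannAlgebra H) : Prop :=
  ∀ (A : Type u) [CStarAlgebra A] [PartialOrder A] [StarOrderedRing A] (S : Submodule ℂ A),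
    (1 : A) ∈ S → (∀ a ∈ S, star a ∈ S) →
    ∀ φ : S →ₗ[ℂ] (H →L[ℂ] H), IsCompletelyPositiveOn S φ → (∀ s, φ s ∈ R) →
      ∃ ψ : A →CP (H →L[ℂ] H), (∀ a, ψ a ∈ R) ∧ ∀ s : S, ψ (s : A) = φ s

/-! ### The Hilbert space `H ⊗ ℓ²(G)` and its block operators -/

/-- The Hilbert space `H ⊗ ℓ²(G)`, realised as the space of square summable families of vectors of
`H` indexed by `G`; the vector `v ⊗ δ_g` is the family with the single entry `v` at `g`. -/
abbrev HilbertL2 (G : Type v) (H : Type u) [NormedAddCommGroup H] : Type (max u v) :=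
  lp (fun _ : G => H) 2

theorem memℓp_two_of_norm_le {G : Type v} {H : Type u} [NormedAddCommGroup H]
    {ξ : HilbertL2 G H} {C : ℝ} {f : G → H}
    (hf : ∀ g, ‖f g‖ ≤ C * ‖ξ g‖) : Memℓp f 2 := by
  refine memℓp_gen ?_
  have hs : Summable fun g => C ^ 2 * ‖ξ g‖ ^ (2 : ℝ≥0∞).toReal :=
    ((lp.memℓp ξ).summable (by norm_num)).mul_left _
  refine hs.of_nonneg_of_le (fun g => by positivity) fun g => ?_
  have := pow_le_pow_left₀ (norm_nonneg (f g)) (hf g) 2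
  simpa [mul_pow] using this

section Operators

variable {H : Type u} [NormedAddCommGroup H] [InnerProductSpace ℂ H] {G : Type v}

open scoped Classical in
/-- The entry `x_(g,h)` of the block matrix of a bounded operator `x` on `H ⊗ ℓ²(G)`. -/
def entry (x : HilbertL2 G H →L[ℂ] HilbertL2 G H) (g h : G) : H →L[ℂ] H :=
  (lp.evalCLM ℂ (fun _ : G => H) 2 g).comp
    (x.comp (lp.singleContinuousLinearMap ℂ (fun _ : G => H) 2 h))

theorem norm_entry_le (x : HilbertL2 G H →L[ℂ] HilbertL2 G H) (g h : G) :
    ‖entry x g h‖ ≤ ‖x‖ := by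
  classical
  refine ContinuousLinearMap.opNorm_le_bound _ (norm_nonneg x) fun v => ?_
  have h1 : entry x g h v = (x (lp.single 2 h v) : HilbertL2 G H) g := by
    unfold entry
    simp only [ContinuousLinearMap.comp_apply, lp.singleContinuousLinearMap_apply]
    convert rfl
    rfl
  rw [h1]
  refine (lp.norm_apply_le_norm (by norm_num) _ g).trans ((x.le_opNorm _).trans ?_)
  rw [lp.norm_single (by norm_num)]

/-- The block diagonal operator `∑ a_g ⊗ e_(g,g)` of a bounded family of operators. -/
def blockDiagonal (a : G → H →L[ℂ] H) (ha : ∃ C : ℝ, ∀ g, ‖a g‖ ≤ C) :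
    HilbertL2 G H →L[ℂ] HilbertL2 G H :=
  LinearMap.mkContinuousOfExistsBound
    { toFun := fun ξ => ⟨fun g => a g (ξ g), by
        obtain ⟨C, hC⟩ := ha
        exact memℓp_two_of_norm_le (ξ := ξ) (C := C) fun g => (a g).le_of_opNorm_le (hC g) _⟩
      map_add' := fun ξ η => by ext g; simp; rfl
      map_smul' := fun c ξ => by ext g; simp }
    (by
      obtain ⟨C, hC⟩ := ha
      refine ⟨|C|, fun ξ => ?_⟩
      refine lp.norm_le_of_tsum_le (p := 2) (by norm_num) (by positivity) ?_
      have h2 : (0 : ℝ) < (2 : ℝ≥0∞).toReal := by norm_num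
      rw [Real.mul_rpow (abs_nonneg _) (norm_nonneg _), lp.norm_rpow_eq_tsum h2, ← tsum_mul_left]
      have hle : ∀ g, ‖a g (ξ g)‖ ^ (2 : ℝ≥0∞).toReal ≤
          |C| ^ (2 : ℝ≥0∞).toReal * ‖ξ g‖ ^ (2 : ℝ≥0∞).toReal := fun g => by
        rw [← Real.mul_rpow (abs_nonneg _) (norm_nonneg _)]
        refine Real.rpow_le_rpow (norm_nonneg _) ?_ h2.le
        exact (a g).le_of_opNorm_le ((hC g).trans (le_abs_self C)) _
      have hs := ((lp.memℓp ξ).summable h2).mul_left (|C| ^ (2 : ℝ≥0∞).toReal)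
      exact (hs.of_nonneg_of_le (fun g => by positivity) hle).tsum_le_tsum hle hs)

/-- The main diagonal `Diag(x) = ∑ x_(g,g) ⊗ e_(g,g)`. -/
def Diag (x : HilbertL2 G H →L[ℂ] HilbertL2 G H) : HilbertL2 G H →L[ℂ] HilbertL2 G H :=
  blockDiagonal (fun g => entry x g g) ⟨‖x‖, fun g => norm_entry_le x g g⟩

variable (H) in
/-- The unitary operator `L_g = I ⊗ λ_g` on `H ⊗ ℓ²(G)`, `L_g (v ⊗ δ_h) = v ⊗ δ_(gh)`. For `H = ℂ` it
is the left translation `λ_g` on `ℓ²(G)`. -/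
def leftTranslation [Group G] (g : G) : HilbertL2 G H →L[ℂ] HilbertL2 G H :=
  LinearMap.mkContinuous
    { toFun := fun ξ => ⟨fun h => ξ (g⁻¹ * h), memℓp_gen
        (((Equiv.mulLeft g⁻¹).summable_iff
          (f := fun h => ‖ξ h‖ ^ (2 : ℝ≥0∞).toReal)).2 ((lp.memℓp ξ).summable (by norm_num)))⟩
      map_add' := fun ξ η => by ext h; simp; rfl
      map_smul' := fun c ξ => by ext h; simp }
    1 (fun ξ => by
      have h2 : (0 : ℝ) < (2 : ℝ≥0∞).toReal := by norm_num
      rw [one_mul]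
      refine lp.norm_le_of_tsum_le h2 (norm_nonneg _) ?_
      rw [lp.norm_rpow_eq_tsum h2]
      exact ((Equiv.mulLeft g⁻¹).tsum_eq (fun h => ‖ξ h‖ ^ (2 : ℝ≥0∞).toReal)).le)

end Operators

/-! ### Crossed products -/

/-- An action of a group on a von Neumann algebra by *-automorphisms. -/
abbrev Action (G : Type v) [Group G] {H : Type u} [NormedAddCommGroup H] [InnerProductSpace ℂ H]
    [CompleteSpace H] (R : VonNeumannAlgebra H) : Type (max u v) :=
  G →* (R.toStarSubalgebra ≃⋆ₐ[ℂ] R.toStarSubalgebra)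

/-- The ultraweak topology on `B(K)`: the coarsest topology for which all the functionals
`x ↦ ∑ ⟨x ξ_n, η_n⟩`, with `(ξ_n)` and `(η_n)` square summable sequences in `K`, are continuous. -/
@[reducible] def ultraweakTopology (K : Type*) [NormedAddCommGroup K] [InnerProductSpace ℂ K] :
    TopologicalSpace (K →L[ℂ] K) :=
  ⨅ (ξ : ℕ → K) (η : ℕ → K) (_ : Summable fun n => ‖ξ n‖ ^ 2) (_ : Summable fun n => ‖η n‖ ^ 2),
    TopologicalSpace.induced (fun x : K →L[ℂ] K => ∑' n, ⟪η n, x (ξ n)⟫_ℂ) inferInstance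

section Crossed

variable {H : Type u} [NormedAddCommGroup H] [InnerProductSpace ℂ H] [CompleteSpace H]
  {G : Type v} [Group G] {R : VonNeumannAlgebra H}

theorem norm_action_le (α : Action G R) (g : G) (r : R.toStarSubalgebra) :
    ‖((α g r : R.toStarSubalgebra) : H →L[ℂ] H)‖ ≤ ‖(r : H →L[ℂ] H)‖ := by
  have hcl : IsClosed (R.toStarSubalgebra : Set (H →L[ℂ] H)) := by
    have h := Set.isClosed_centralizer (Set.centralizer (R : Set (H →L[ℂ] H)))
    rw [VonNeumannAlgebra.centralizer_centralizer] at h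
    exact h
  have := hcl
  exact NonUnitalStarAlgHom.norm_apply_le (α g) r

/-- The representation `Ψ(r) = ∑ α_(g⁻¹)(r) ⊗ e_(g,g)` of `R` on `H ⊗ ℓ²(G)`. -/
def Psi (α : Action G R) (r : R.toStarSubalgebra) : HilbertL2 G H →L[ℂ] HilbertL2 G H :=
  blockDiagonal (fun g => (α g⁻¹ r : R.toStarSubalgebra))
    ⟨‖(r : H →L[ℂ] H)‖, fun g => norm_action_le α g⁻¹ r⟩

/-- The crossed product `L(R, α, G)`: the ultraweak closure of the linear span of the operators
`L_g Ψ(r)`. -/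
def crossedProduct (α : Action G R) : Set (HilbertL2 G H →L[ℂ] HilbertL2 G H) :=
  @closure _ (ultraweakTopology (HilbertL2 G H))
    (Submodule.span ℂ {x | ∃ (g : G) (r : R.toStarSubalgebra), x = leftTranslation H g * Psi α r} :
      Set (HilbertL2 G H →L[ℂ] HilbertL2 G H))

/-- A complex function `χ` on a group is positive definite if all the matrices `(χ(g_i⁻¹ g_j))` are
positive semidefinite. -/
def IsPositiveDefinite (χ : G → ℂ) : Prop :=
  ∀ (n : ℕ) (g : Fin n → G), (Matrix.of fun i j => χ ((g i)⁻¹ * g j)).PosSemidef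

/-- `(χ, σ)` is an unbounded expectation of `B(H ⊗ ℓ²(G))` to `L(R, α, G)`. -/
structure IsUnboundedExpectation (α : Action G R) (χ : G → ℝ)
    (σ : (HilbertL2 G H →L[ℂ] HilbertL2 G H) →CP (HilbertL2 G H →L[ℂ] HilbertL2 G H)) : Prop where
  pos : ∀ g, 0 < χ g
  posDef : IsPositiveDefinite fun g => (χ g : ℂ)
  mem : ∀ x, σ x ∈ crossedProduct α
  unital : σ 1 = 1
  bimodular : ∀ (r s : R.toStarSubalgebra) (x : HilbertL2 G H →L[ℂ] HilbertL2 G H),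
    σ (Psi α r * x * Psi α s) = Psi α r * σ x * Psi α s
  eigen : ∀ (g : G) (r : R.toStarSubalgebra),
    σ (leftTranslation H g * Psi α r) = (χ g : ℂ) • (leftTranslation H g * Psi α r)
  norm_Diag_le : ∀ (x : HilbertL2 G H →L[ℂ] HilbertL2 G H) (g : G),
    ‖Diag (leftTranslation H g⁻¹ * σ x)‖ ≤ χ g * ‖x‖

variable (R) in
/-- A completely positive conditional expectation of `B(H)` onto `R`. -/
structure ConditionalExpectation where
  /-- The underlying completely positive map. -/
  toCP : (H →L[ℂ] H) →CP (H →L[ℂ] H)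
  mem : ∀ x, toCP x ∈ R.toStarSubalgebra
  fixes : ∀ r ∈ R.toStarSubalgebra, toCP r = r
  bimodular : ∀ r ∈ R.toStarSubalgebra, ∀ s ∈ R.toStarSubalgebra, ∀ x,
    toCP (r * x * s) = r * toCP x * s

/-- A conditional expectation of `B(H)` onto `R`, as a map with values in `R`. -/
def ConditionalExpectation.toFun (π : ConditionalExpectation R) (x : H →L[ℂ] H) :
    R.toStarSubalgebra :=
  ⟨π.toCP x, π.mem x⟩

/-- `σ` is the map `σ_ξ` given, for `ξ = (k_g)` in `ℓ²(G)`, by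
`σ_ξ(x) = ∑_(g,h) L_(gh⁻¹) Ψ(α_h(π(x_(g,h)))) conj(k_g) k_h`, where the sum over `G × G` converges
in norm at each entry of the block matrices. -/
def IsSigma (α : Action G R) (π : ConditionalExpectation R) (ξ : HilbertL2 G ℂ)
    (σ : (HilbertL2 G H →L[ℂ] HilbertL2 G H) → (HilbertL2 G H →L[ℂ] HilbertL2 G H)) : Prop :=
  ∀ (x : HilbertL2 G H →L[ℂ] HilbertL2 G H) (a b : G),
    HasSum (fun p : G × G => entry ((star (ξ p.1) * ξ p.2) •
      (leftTranslation H (p.1 * p.2⁻¹) * Psi α (α p.2 (π.toFun (entry x p.1 p.2))))) a b)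
      (entry (σ x) a b)

end Crossed

end CrossedProduct

end

/-!
Injectivity, applied to the inclusion of `R` in `B(H)`, extends the identity of `R` to a completely
positive map `π : B(H) → R`. A vector argument on the positive matrices `(π (aᵢ* aⱼ))` shows that
`π` is `R`-bimodular and contractive (`exists_conditionalExpectation`, `norm_map_le_of_map_one`).

The vector `ξ = (k_g)` is free to choose, and it is taken in `ℓ¹(G)` as well as in `ℓ²(G)`. The
summand of `σ_ξ(x)` with index `(g, h)` has norm at most `k_g k_h ‖x‖`, so the series converges
absolutely in norm. Hence `σ_ξ(x)` is a norm limit, a fortiori an ultraweak limit, of elements of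
the span of the `L_g Ψ(r)`.

Complete positivity comes from the covariance relation `L_g Ψ(r) = Ψ(α_g(r)) L_g`, which turns the
`(g, h)`-summand into `k_g L_g Ψ(π(x_(g,h))) (k_h L_h)^*`. A partial sum over `F × F` is therefore a
compression of the amplification of `Ψ ∘ π` applied to the finite block matrix `(x_(g,h))`
(`isPosForm_sum_sigmaTerm`). Positivity of matrices over `R` is independent of the faithful
representation in which it is tested (`IsPosForm.map_of_injective`), which is how it is carried
from `B(H)` to `B(H ⊗ ℓ²(G))` by `Ψ`.

The entry of `L_g Ψ(r)` at `(a, b)` vanishes unless `a = g b`. So the series for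
`σ_ξ(L_g Ψ(r))`, and the one for an entry of `L_(g⁻¹) σ_ξ(x)` on the main diagonal, reduce to the
terms with index `(g h, h)`, whose weights sum to `∑ k_(gh) k_h = ⟨λ_g ξ, ξ⟩ = χ(g)`.
-/

noncomputable section

namespace CrossedProduct

/-! ### Positive operator matrices -/

/-- An injective *-homomorphism of C*-algebras reflects positivity, since it commutes with taking
negative parts. -/
theorem nonneg_of_map_nonneg {A B : Type*} [NonUnitalCStarAlgebra A]
    [PartialOrder A] [StarOrderedRing A] [NonUnitalCStarAlgebra B] [PartialOrder B]
    [StarOrderedRing B] (φ : A →⋆ₙₐ[ℂ] B) (hφ : Function.Injective φ) {a : A} (ha : 0 ≤ φ a) :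
    0 ≤ a := by
  have hsa : IsSelfAdjoint a := hφ (by rw [map_star]; exact ha.isSelfAdjoint)
  refine (CFC.negPart_eq_zero_iff a hsa).1 (hφ ?_)
  have hc : Continuous φ := (NonUnitalStarAlgHom.isometry φ hφ).continuous
  rw [map_zero, ← (CFC.negPart_eq_zero_iff (φ a) ha.isSelfAdjoint).2 ha, CFC.negPart_def,
    CFC.negPart_def]
  exact φ.map_cfcₙ _ a (hf₀ := by simp) (hφ := hc) (ha := hsa) (hφa := ha.isSelfAdjoint)

section Forms

variable {ι : Type*} [Fintype ι] {K : Type*} [NormedAddCommGroup K] [InnerProductSpace ℂ K]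

/-- A square matrix of bounded operators on `K` is positive as an operator on the direct sum of
copies of `K`, expressed through its quadratic form. -/
def IsPosForm (M : ι → ι → K →L[ℂ] K) : Prop :=
  ∀ v : ι → K, 0 ≤ ∑ i, ∑ j, ⟪v i, M i j (v j)⟫_ℂ

/-- The operator on the Hilbert direct sum `K^ι` with a given matrix of operators on `K`. -/
def matrixOperator (M : ι → ι → K →L[ℂ] K) :
    PiLp 2 (fun _ : ι => K) →L[ℂ] PiLp 2 (fun _ : ι => K) where
  toFun v := WithLp.toLp 2 fun i => ∑ j, M i j (v j)
  map_add' v w := by ext i; simp [Finset.sum_add_distrib]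
  map_smul' c v := by ext i; simp [Finset.smul_sum]
  cont := by fun_prop

@[simp]
theorem matrixOperator_apply (M : ι → ι → K →L[ℂ] K) (v : PiLp 2 (fun _ : ι => K)) (i : ι) :
    matrixOperator M v i = ∑ j, M i j (v j) := rfl

theorem inner_matrixOperator (M : ι → ι → K →L[ℂ] K) (v w : PiLp 2 (fun _ : ι => K)) :
    ⟪v, matrixOperator M w⟫_ℂ = ∑ i, ∑ j, ⟪v i, M i j (w j)⟫_ℂ := by
  simp [PiLp.inner_apply, inner_sum]

theorem matrixOperator_nonneg_iff (M : ι → ι → K →L[ℂ] K) :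
    0 ≤ matrixOperator M ↔ IsPosForm M := by
  rw [ContinuousLinearMap.nonneg_iff_isPositive]
  constructor
  · intro h v
    have := h.inner_nonneg_right (WithLp.toLp 2 v)
    rwa [inner_matrixOperator] at this
  · intro h
    rw [ContinuousLinearMap.isPositive_iff_complex]
    intro v
    have h' : 0 ≤ ⟪matrixOperator M v, v⟫_ℂ := by
      rw [← inner_conj_symm, inner_matrixOperator]
      exact star_nonneg_iff.2 (h v)
    exact ⟨(Complex.eq_re_of_ofReal_le h').symm, (Complex.nonneg_iff.1 h').1⟩

variable [CompleteSpace K]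

/-- The amplification of a representation `ρ` of a C*-algebra on `K` to the representation of the
matrices over the algebra on `K^ι`. -/
def amplification {A : Type*} [CStarAlgebra A] (ι : Type*) [Fintype ι]
    (ρ : A →⋆ₐ[ℂ] (K →L[ℂ] K)) :
    CStarMatrix ι ι A →⋆ₙₐ[ℂ] (PiLp 2 (fun _ : ι => K) →L[ℂ] PiLp 2 (fun _ : ι => K)) where
  toFun M := matrixOperator fun i j => ρ (M i j)
  map_smul' c M := by ext v i; simp [Finset.smul_sum]
  map_zero' := by ext v i; simp
  map_add' M N := by ext v i; simp [Finset.sum_add_distrib]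
  map_mul' M N := by
    ext v i
    simp only [matrixOperator_apply, CStarMatrix.mul_apply, map_sum, map_mul,
      mul_apply_eq_comp, sum_apply]
    exact Finset.sum_comm
  map_star' M := by
    rw [ContinuousLinearMap.star_eq_adjoint, ContinuousLinearMap.eq_adjoint_iff]
    intro v w
    rw [inner_matrixOperator, ← inner_conj_symm, inner_matrixOperator, Finset.sum_comm]
    simp only [map_sum, inner_conj_symm, CStarMatrix.star_apply, map_star,
      ContinuousLinearMap.star_eq_adjoint, ContinuousLinearMap.adjoint_inner_left]

theorem amplification_injective {A : Type*} [CStarAlgebra A] {ρ : A →⋆ₐ[ℂ] (K →L[ℂ] K)}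
    (hρ : Function.Injective ρ) : Function.Injective (amplification ι ρ) := by
  classical
  intro M N h
  ext i j
  refine hρ (ContinuousLinearMap.ext fun v => ?_)
  have := congr(($h (PiLp.single 2 j v)) i)
  simpa [amplification, PiLp.single_apply, apply_ite] using this

/-- Positivity of an operator matrix only depends on the C*-algebra generated by its entries: a
faithful representation detects positivity of matrices over a C*-algebra, and every
representation preserves it. -/
theorem IsPosForm.map_of_injective {A : Type*} [CStarAlgebra A] {L : Type*} [NormedAddCommGroup L]
    [InnerProductSpace ℂ L] [CompleteSpace L] {j : A →⋆ₐ[ℂ] (K →L[ℂ] K)}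
    (hj : Function.Injective j) (ρ : A →⋆ₐ[ℂ] (L →L[ℂ] L)) {M : ι → ι → A}
    (hM : IsPosForm fun i k => j (M i k)) : IsPosForm fun i k => ρ (M i k) := by
  let _ : PartialOrder A := CStarAlgebra.spectralOrder A
  have _ : StarOrderedRing A := CStarAlgebra.spectralOrderedRing A
  have h0 : 0 ≤ CStarMatrix.ofMatrix (Matrix.of M) :=
    nonneg_of_map_nonneg (amplification ι j) (amplification_injective hj)
      ((matrixOperator_nonneg_iff _).2 hM)
  exact (matrixOperator_nonneg_iff _).1 (map_nonneg (amplification ι ρ) h0)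

/-- Over `B(K)`, positivity in the C*-algebra of matrices is positivity of the quadratic form. -/
theorem cstarMatrix_nonneg_iff_isPosForm (M : CStarMatrix ι ι (K →L[ℂ] K)) :
    0 ≤ M ↔ IsPosForm fun i j => M i j := by
  rw [← matrixOperator_nonneg_iff]
  exact ⟨fun h => map_nonneg (amplification ι (StarAlgHom.id ℂ (K →L[ℂ] K))) h, fun h =>
    nonneg_of_map_nonneg (amplification ι (StarAlgHom.id ℂ (K →L[ℂ] K)))
      (amplification_injective Function.injective_id) h⟩

theorem IsPosForm.map_completelyPositive {L : Type*} [NormedAddCommGroup L]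
    [InnerProductSpace ℂ L] [CompleteSpace L] (φ : (K →L[ℂ] K) →CP (L →L[ℂ] L))
    {M : ι → ι → K →L[ℂ] K} (hM : IsPosForm M) : IsPosForm fun i j => φ (M i j) :=
  (cstarMatrix_nonneg_iff_isPosForm _).1 (φ.map_cstarMatrix_nonneg
    (CStarMatrix.ofMatrix (Matrix.of M)) ((cstarMatrix_nonneg_iff_isPosForm _).2 hM))

end Forms

/-! ### Conditional expectations onto injective von Neumann algebras -/

section Multiplicative

variable {H : Type*} [NormedAddCommGroup H] [InnerProductSpace ℂ H] [CompleteSpace H]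

theorem apply_eq_zero_of_inner_eq_zero {T : H →L[ℂ] H} (hT : 0 ≤ T) {v : H}
    (hv : ⟪v, T v⟫_ℂ = 0) : T v = 0 := by
  obtain ⟨S, rfl⟩ := CStarAlgebra.nonneg_iff_eq_star_mul_self.1 hT
  rw [mul_apply_eq_comp, ContinuousLinearMap.star_eq_adjoint,
    ContinuousLinearMap.adjoint_inner_right, inner_self_eq_zero] at hv
  rw [mul_apply_eq_comp, hv, map_zero]

/-- A null vector of a positive quadratic form lies in its kernel. -/
theorem IsPosForm.sum_apply_eq_zero {ι : Type*} [Fintype ι] {M : ι → ι → H →L[ℂ] H}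
    (hM : IsPosForm M) {v : ι → H} (hv : ∑ i, ∑ j, ⟪v i, M i j (v j)⟫_ℂ = 0) (i : ι) :
    ∑ j, M i j (v j) = 0 := by
  have h1 : ⟪WithLp.toLp 2 v, matrixOperator M (WithLp.toLp 2 v)⟫_ℂ = 0 := by
    rwa [inner_matrixOperator]
  have h2 := apply_eq_zero_of_inner_eq_zero ((matrixOperator_nonneg_iff M).2 hM) h1
  simpa using congr(($h2) i)

theorem isPosForm_star_mul {ι : Type*} [Fintype ι] (a : ι → H →L[ℂ] H) :
    IsPosForm fun i j => star (a i) * a j := by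
  intro v
  have : ∑ i, ∑ j, ⟪v i, (star (a i) * a j) (v j)⟫_ℂ = ⟪∑ i, a i (v i), ∑ i, a i (v i)⟫_ℂ := by
    simp only [sum_inner, inner_sum, ContinuousLinearMap.star_eq_adjoint,
      ContinuousLinearMap.adjoint_inner_right, mul_apply_eq_comp]
    exact Finset.sum_comm
  rw [this, inner_self_eq_norm_sq_to_K]
  simp

variable (θ : (H →L[ℂ] H) →CP (H →L[ℂ] H))

/-- A completely positive map that fixes `1`, `r` and `r* r` is right modular over `r`: the vector
`(-r h, h, 0)` is null for the positive form of the matrix `θ (aᵢ* aⱼ)`, where `a = (1, r, x)`. -/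
theorem map_mul_of_fixed (h1 : θ 1 = 1) {r : H →L[ℂ] H} (hr : θ r = r)
    (hr' : θ (star r) = star r) (hrr : θ (star r * r) = star r * r) (x : H →L[ℂ] H) :
    θ (x * r) = θ x * r := by
  ext h
  have hpos := (isPosForm_star_mul ![1, r, star x]).map_completelyPositive θ
  have := hpos.sum_apply_eq_zero (v := ![-r h, h, 0]) (by
    simp [Fin.sum_univ_three, h1, hr, hr', hrr]) 2
  exact (neg_add_eq_zero.1 (by simpa [Fin.sum_univ_three] using this)).symm

/-- A unital completely positive map is contractive, by the Kadison–Schwarz inequality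
`θ(x)* θ(x) ≤ θ(x* x)`. -/
theorem norm_map_le_of_map_one (h1 : θ 1 = 1) (x : H →L[ℂ] H) : ‖θ x‖ ≤ ‖x‖ := by
  refine ContinuousLinearMap.opNorm_le_bound _ (norm_nonneg x) fun k => ?_
  -- The value of the form at `(-θ(x) k, k)` is `⟨k, θ(x* x) k⟩ - ‖θ(x) k‖²`.
  have hpos := (isPosForm_star_mul ![1, x]).map_completelyPositive θ ![-θ x k, k]
  have hx : ‖θ (star x * x)‖ ≤ ‖x‖ ^ 2 := by
    refine ((PositiveLinearMap.ofClass θ).norm_apply_le_of_nonneg _ (star_mul_self_nonneg x)).trans ?_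
    rw [CStarRing.norm_star_mul_self, ← sq]
    refine mul_le_of_le_one_left (by positivity) ?_
    change ‖θ 1‖ ≤ 1
    rw [h1]; exact ContinuousLinearMap.norm_id_le
  have h2 : ‖θ x k‖ ^ 2 ≤ (⟪k, θ (star x * x) k⟫_ℂ).re := by
    have h3 : (⟪k, (star (θ x)) (θ x k)⟫_ℂ).re ≤ (⟪k, θ (star x * x) k⟫_ℂ).re := by
      simpa [Fin.sum_univ_two, h1, map_star] using (Complex.nonneg_iff.1 hpos).1
    rwa [ContinuousLinearMap.star_eq_adjoint, ContinuousLinearMap.adjoint_inner_right,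
      inner_self_eq_norm_sq_to_K, ← RCLike.ofReal_pow, RCLike.ofReal_eq_complex_ofReal,
      Complex.ofReal_re] at h3
  have h3 : (⟪k, θ (star x * x) k⟫_ℂ).re ≤ (‖x‖ * ‖k‖) ^ 2 := by
    refine (Complex.re_le_norm _).trans ((norm_inner_le_norm _ _).trans ?_)
    have := (θ (star x * x)).le_of_opNorm_le hx k
    nlinarith [norm_nonneg k]
  exact le_of_sq_le_sq (h2.trans h3) (by positivity)

end Multiplicative

/-- The identity of an injective von Neumann algebra `R` extends to a completely positive map of
`B(H)` into `R`, and such an extension is automatically `R`-bimodular. -/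
theorem exists_conditionalExpectation {H : Type*} [NormedAddCommGroup H] [InnerProductSpace ℂ H]
    [CompleteSpace H] {R : VonNeumannAlgebra H} (hR : IsInjective R) :
    Nonempty (ConditionalExpectation R) := by
  obtain ⟨θ, hmem, hfix⟩ := hR (H →L[ℂ] H) (Subalgebra.toSubmodule R.toStarSubalgebra.toSubalgebra)
    (one_mem R.toStarSubalgebra) (fun a ha => R.star_mem' ha)
    (Submodule.subtype _) (fun k M h => h) (fun s => s.2)
  have hfix' : ∀ r ∈ R.toStarSubalgebra, θ r = r := fun r hr => hfix ⟨r, hr⟩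
  have hright : ∀ r ∈ R.toStarSubalgebra, ∀ x, θ (x * r) = θ x * r := fun r hr x =>
    map_mul_of_fixed θ (hfix' 1 (one_mem _)) (hfix' r hr) (hfix' _ (star_mem hr))
      (hfix' _ (mul_mem (star_mem hr) hr)) x
  refine ⟨⟨θ, hmem, hfix', fun r hr s hs x => ?_⟩⟩
  rw [hright s hs]
  congr 1
  apply star_injective
  rw [← map_star, star_mul, star_mul, hright _ (star_mem hr),
    map_star]

/-! ### Block entries, left translations and the representation `Ψ` -/

section Blocks

variable {H : Type*} [NormedAddCommGroup H] [InnerProductSpace ℂ H] {G : Type*}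

theorem entry_apply [inst : DecidableEq G] (x : HilbertL2 G H →L[ℂ] HilbertL2 G H) (g h : G)
    (v : H) : entry x g h v = x (lp.single 2 h v) g := by
  obtain rfl : inst = fun a b => Classical.propDecidable (a = b) := Subsingleton.elim _ _
  rfl

/-- The entry `x ↦ x_(g,h)` as a bounded linear map. -/
def entryCLM (H : Type*) [NormedAddCommGroup H] [InnerProductSpace ℂ H] {G : Type*} (g h : G) :
    (HilbertL2 G H →L[ℂ] HilbertL2 G H) →L[ℂ] (H →L[ℂ] H) :=
  LinearMap.mkContinuous
    { toFun := fun x : HilbertL2 G H →L[ℂ] HilbertL2 G H => entry x g h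
      map_add' := fun x y => by classical ext v; simp [entry_apply]
      map_smul' := fun c x => by classical ext v; simp [entry_apply] } 1
    fun x => by simpa using norm_entry_le x g h

@[simp]
theorem entryCLM_apply (x : HilbertL2 G H →L[ℂ] HilbertL2 G H) (g h : G) :
    entryCLM H g h x = entry x g h := rfl

theorem norm_blockDiagonal_le (a : G → H →L[ℂ] H) (ha : ∃ C : ℝ, ∀ g, ‖a g‖ ≤ C) {C : ℝ}
    (hC : 0 ≤ C) (h : ∀ g, ‖a g‖ ≤ C) : ‖blockDiagonal a ha‖ ≤ C := by
  refine ContinuousLinearMap.opNorm_le_bound _ hC fun ξ => ?_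
  have h2 : (0 : ℝ) < (2 : ℝ≥0∞).toReal := by norm_num
  refine lp.norm_le_of_forall_sum_le h2 (by positivity) fun s => ?_
  rw [Real.mul_rpow hC (norm_nonneg _)]
  refine le_trans ?_ (mul_le_mul_of_nonneg_left (lp.sum_rpow_le_norm_rpow h2 ξ s) (by positivity))
  rw [Finset.mul_sum]
  refine Finset.sum_le_sum fun g _ => ?_
  rw [← Real.mul_rpow hC (norm_nonneg _)]
  exact Real.rpow_le_rpow (norm_nonneg _) ((a g).le_of_opNorm_le (h g) _) h2.le

variable [Group G]

@[simp]
theorem leftTranslation_apply (g : G) (ξ : HilbertL2 G H) (h : G) :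
    leftTranslation H g ξ h = ξ (g⁻¹ * h) := rfl

theorem leftTranslation_mul (g h : G) :
    leftTranslation H (g * h) = leftTranslation H g * leftTranslation H h := by
  ext ξ k
  simp [mul_assoc]

@[simp]
theorem leftTranslation_one : leftTranslation H (1 : G) = 1 := by
  ext ξ k
  simp

theorem norm_leftTranslation_le (g : G) : ‖leftTranslation H g‖ ≤ 1 :=
  LinearMap.mkContinuous_norm_le _ zero_le_one _

theorem inner_leftTranslation (g : G) (ξ η : HilbertL2 G H) :
    ⟪ξ, leftTranslation H g η⟫_ℂ = ⟪leftTranslation H g⁻¹ ξ, η⟫_ℂ := by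
  rw [lp.inner_eq_tsum, lp.inner_eq_tsum, ← (Equiv.mulLeft g).tsum_eq]
  simp

theorem entry_leftTranslation_mul (g : G) (x : HilbertL2 G H →L[ℂ] HilbertL2 G H) (a b : G) :
    entry (leftTranslation H g * x) a b = entry x (g⁻¹ * a) b := by
  classical
  ext v
  simp [entry_apply]

end Blocks

section Representation

variable {H : Type*} [NormedAddCommGroup H] [InnerProductSpace ℂ H] [CompleteSpace H]
  {G : Type*} [Group G] {R : VonNeumannAlgebra H} (α : Action G R)

theorem action_mul_apply (g h : G) (r : R.toStarSubalgebra) : α (g * h) r = α g (α h r) := by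
  rw [map_mul]
  rfl

@[simp]
theorem Psi_apply (r : R.toStarSubalgebra) (ξ : HilbertL2 G H) (g : G) :
    Psi α r ξ g = (α g⁻¹ r : R.toStarSubalgebra).1 (ξ g) := rfl

/-- The map `Ψ` as a *-representation of `R`. -/
def PsiHom : R.toStarSubalgebra →⋆ₐ[ℂ] (HilbertL2 G H →L[ℂ] HilbertL2 G H) where
  toFun := Psi α
  map_one' := by ext ξ g; simp
  map_mul' r s := by ext ξ g; simp
  map_zero' := by ext ξ g; simp
  map_add' r s := by ext ξ g; simp
  commutes' c := by
    ext ξ g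
    simp [Algebra.algebraMap_eq_smul_one]
  map_star' r := by
    rw [ContinuousLinearMap.star_eq_adjoint, ContinuousLinearMap.eq_adjoint_iff]
    intro ξ η
    rw [lp.inner_eq_tsum, lp.inner_eq_tsum]
    refine tsum_congr fun g => ?_
    rw [Psi_apply, Psi_apply, map_star]
    exact ContinuousLinearMap.adjoint_inner_left _ _ _

@[simp]
theorem PsiHom_apply (r : R.toStarSubalgebra) : PsiHom α r = Psi α r := rfl

theorem norm_Psi_le (r : R.toStarSubalgebra) : ‖Psi α r‖ ≤ ‖(r : H →L[ℂ] H)‖ :=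
  norm_blockDiagonal_le _ _ (norm_nonneg _) fun _ => norm_action_le α _ r

/-- The covariance relation between `L` and `Ψ`. -/
theorem leftTranslation_mul_Psi (g : G) (r : R.toStarSubalgebra) :
    leftTranslation H g * Psi α r = Psi α (α g r) * leftTranslation H g := by
  ext ξ h
  simp only [mul_apply_eq_comp, leftTranslation_apply, Psi_apply, ← action_mul_apply]
  simp

theorem entry_leftTranslation_mul_Psi [DecidableEq G] (g : G) (r : R.toStarSubalgebra) (a b : G) :
    entry (leftTranslation H g * Psi α r) a b =
      if a = g * b then (α b⁻¹ r : R.toStarSubalgebra).1 else 0 := by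
  ext v
  rw [entry_leftTranslation_mul, entry_apply, Psi_apply, lp.single_apply]
  by_cases h : a = g * b
  · subst h; simp
  · have h' : g⁻¹ * a ≠ b := fun e => h (by rw [← e, mul_inv_cancel_left])
    simp [h, h']

theorem entry_Psi_mul_mul_Psi (r s : R.toStarSubalgebra)
    (x : HilbertL2 G H →L[ℂ] HilbertL2 G H) (a b : G) :
    entry (Psi α r * x * Psi α s) a b =
      (α a⁻¹ r : R.toStarSubalgebra).1 * entry x a b * (α b⁻¹ s : R.toStarSubalgebra).1 := by
  classical
  ext v
  have : Psi α s (lp.single 2 b v) = lp.single 2 b ((α b⁻¹ s : R.toStarSubalgebra).1 v) := by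
    ext g
    by_cases h : g = b
    · subst h; simp
    · simp [h]
  simp [entry_apply, this]

end Representation

/-! ### Norm limits are ultraweak limits -/

theorem continuous_tsum_of_le {E : Type*} [NormedAddCommGroup E] [NormedSpace ℂ E]
    (f : ℕ → E →L[ℂ] ℂ) {c : ℕ → ℝ} (hc : Summable c) (hc0 : ∀ n, 0 ≤ c n)
    (hf : ∀ n x, ‖f n x‖ ≤ c n * ‖x‖) : Continuous fun x => ∑' n, f n x := by
  have hs : Summable f :=
    Summable.of_norm_bounded hc fun n => (f n).opNorm_le_bound (hc0 n) (hf n)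
  have h : (fun x => ∑' n, f n x) = ∑' n, f n := by
    ext x
    exact (hs.hasSum.mapL (ContinuousLinearMap.apply ℂ ℂ x)).tsum_eq
  rw [h]
  exact (∑' n, f n).continuous

/-- The norm topology is finer than the ultraweak topology. -/
theorem le_ultraweakTopology (K : Type*) [NormedAddCommGroup K] [InnerProductSpace ℂ K] :
    (inferInstance : TopologicalSpace (K →L[ℂ] K)) ≤ ultraweakTopology K := by
  refine le_iInf fun ξ => le_iInf fun η => le_iInf fun hξ => le_iInf fun hη => ?_
  rw [← continuous_iff_le_induced]
  refine continuous_tsum_of_le (E := K →L[ℂ] K)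
    (fun n => (innerSL ℂ (η n)).comp (ContinuousLinearMap.apply ℂ K (ξ n)))
    (c := fun n => ‖ξ n‖ ^ 2 + ‖η n‖ ^ 2) (hξ.add hη) (fun n => by positivity) fun n x => ?_
  calc ‖⟪η n, x (ξ n)⟫_ℂ‖ ≤ ‖η n‖ * (‖x‖ * ‖ξ n‖) :=
        (norm_inner_le_norm _ _).trans (mul_le_mul_of_nonneg_left (x.le_opNorm _) (norm_nonneg _))
    _ = (‖ξ n‖ * ‖η n‖) * ‖x‖ := by ring
    _ ≤ _ := by
        refine mul_le_mul_of_nonneg_right ?_ (norm_nonneg x)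
        nlinarith [sq_nonneg (‖ξ n‖ - ‖η n‖), sq_nonneg (‖ξ n‖ + ‖η n‖)]

theorem mem_crossedProduct_of_hasSum {H : Type*} [NormedAddCommGroup H] [InnerProductSpace ℂ H]
    [CompleteSpace H] {G : Type*} [Group G] {R : VonNeumannAlgebra H} (α : Action G R)
    {ι : Type*} {c : ι → ℂ} {g : ι → G} {r : ι → R.toStarSubalgebra}
    {x : HilbertL2 G H →L[ℂ] HilbertL2 G H}
    (hx : HasSum (fun i => c i • (leftTranslation H (g i) * Psi α (r i))) x) :
    x ∈ crossedProduct α := by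
  refine closure.mono (le_ultraweakTopology _) ?_
  refine mem_closure_of_tendsto hx (.of_forall fun s => ?_)
  exact Submodule.sum_mem _ fun i _ => Submodule.smul_mem _ _ (Submodule.subset_span ⟨_, _, rfl⟩)

/-! ### The averaging map `σ_ξ` for an absolutely summable unit vector -/

/-- A strictly positive, summable family whose squares sum to `1`: the coefficients of a strictly
positive unit vector of `ℓ²(G)` that lies in `ℓ¹(G)`. -/
structure IsWeight {G : Type*} (k : G → ℝ) : Prop where
  pos : ∀ g, 0 < k g
  summable : Summable k
  hasSum_sq : HasSum (fun g => k g ^ 2) 1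

theorem exists_isWeight (G : Type*) [Countable G] [Nonempty G] : ∃ k : G → ℝ, IsWeight k := by
  have := Encodable.ofCountable G
  obtain ⟨f, hf0, c, hfc, -⟩ := posSumOfEncodable one_pos G
  have hs2 : Summable fun g => f g ^ 2 := by
    refine (hfc.summable.mul_left c).of_nonneg_of_le (fun g => sq_nonneg _) fun g => ?_
    rw [sq]
    exact mul_le_mul_of_nonneg_right (le_hasSum hfc g fun i _ => (hf0 i).le) (hf0 g).le
  have hpos : 0 < ∑' g, f g ^ 2 :=
    hs2.tsum_pos (fun g => sq_nonneg _) (Classical.arbitrary G) (pow_pos (hf0 _) 2)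
  refine ⟨fun g => f g / √(∑' g, f g ^ 2), fun g => div_pos (hf0 g) (Real.sqrt_pos.2 hpos),
    hfc.summable.div_const _, ?_⟩
  have := hs2.hasSum.div_const (∑' g, f g ^ 2)
  rw [div_self hpos.ne'] at this
  simpa only [div_pow, Real.sq_sqrt hpos.le] using this

section Positivity

variable {H : Type*} [NormedAddCommGroup H] [InnerProductSpace ℂ H] {G : Type*}

/-- Splitting every entry of a positive matrix of operators on `H ⊗ ℓ²(G)` into finitely many
blocks gives a positive matrix of operators on `H`. -/
theorem IsPosForm.entry {ι : Type*} [Fintype ι]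
    {M : ι → ι → HilbertL2 G H →L[ℂ] HilbertL2 G H} (hM : IsPosForm M) (F : Finset G) :
    IsPosForm fun i j : ι × F => entry (M i.1 j.1) i.2 j.2 := by
  classical
  intro w
  have h := hM fun i => ∑ g : F, lp.single 2 (g : G) (w (i, g))
  simp only [map_sum, sum_inner, inner_sum, lp.inner_single_left] at h
  simp only [Fintype.sum_prod_type, entry_apply]
  convert h using 2 with i
  rw [Finset.sum_comm]
  refine Finset.sum_congr rfl fun j _ => ?_
  rw [Finset.sum_comm]

end Positivity

section Sigma

variable {H : Type*} [NormedAddCommGroup H] [InnerProductSpace ℂ H] [CompleteSpace H]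
  {G : Type*} [Group G] {R : VonNeumannAlgebra H} (α : Action G R) (π : ConditionalExpectation R)
  {k : G → ℝ}

@[simp]
theorem ConditionalExpectation.coe_toFun (x : H →L[ℂ] H) :
    (π.toFun x : H →L[ℂ] H) = π.toCP x := rfl

theorem ConditionalExpectation.map_one : π.toCP 1 = 1 := π.fixes 1 (one_mem _)

theorem ConditionalExpectation.toFun_coe (r : R.toStarSubalgebra) : π.toFun r = r :=
  Subtype.ext (π.fixes r r.2)

theorem ConditionalExpectation.toFun_zero : π.toFun 0 = 0 := Subtype.ext (map_zero π.toCP)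

theorem ConditionalExpectation.toFun_mul_mul (r s : R.toStarSubalgebra) (x : H →L[ℂ] H) :
    π.toFun (r * x * s) = r * π.toFun x * s :=
  Subtype.ext (π.bimodular r r.2 s s.2 x)

theorem ConditionalExpectation.norm_toFun_le (x : H →L[ℂ] H) :
    ‖(π.toFun x : H →L[ℂ] H)‖ ≤ ‖x‖ :=
  norm_map_le_of_map_one π.toCP π.map_one x

variable (k) in
/-- The `(g,h)`-summand of the series defining `σ_ξ(x)`, as a linear map in `x`. -/
def sigmaTerm (p : G × G) :
    (HilbertL2 G H →L[ℂ] HilbertL2 G H) →ₗ[ℂ] (HilbertL2 G H →L[ℂ] HilbertL2 G H) where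
  toFun x := ((k p.1 * k p.2 : ℝ) : ℂ) •
    (leftTranslation H (p.1 * p.2⁻¹) * Psi α (α p.2 (π.toFun (entry x p.1 p.2))))
  map_add' x y := by
    have : π.toFun (entry (x + y) p.1 p.2) =
        π.toFun (entry x p.1 p.2) + π.toFun (entry y p.1 p.2) := by
      refine Subtype.ext ?_
      have := map_add (entryCLM H p.1 p.2) x y
      simp only [entryCLM_apply] at this
      simp [this]
    rw [this, map_add, ← PsiHom_apply, map_add, mul_add, smul_add]
    rfl
  map_smul' c x := by
    have : π.toFun (entry (c • x) p.1 p.2) = c • π.toFun (entry x p.1 p.2) := by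
      refine Subtype.ext ?_
      have := map_smul (entryCLM H p.1 p.2) c x
      simp only [entryCLM_apply] at this
      simp [this]
    rw [this, map_smul, ← PsiHom_apply, map_smul, mul_smul_comm, smul_comm]
    rfl

theorem sigmaTerm_apply (p : G × G) (x : HilbertL2 G H →L[ℂ] HilbertL2 G H) :
    sigmaTerm α π k p x = ((k p.1 * k p.2 : ℝ) : ℂ) •
      (leftTranslation H (p.1 * p.2⁻¹) * Psi α (α p.2 (π.toFun (entry x p.1 p.2)))) := rfl

/-- The summand in the form that exhibits complete positivity. -/
theorem sigmaTerm_eq_conj (p : G × G) (x : HilbertL2 G H →L[ℂ] HilbertL2 G H) :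
    sigmaTerm α π k p x = ((k p.1 * k p.2 : ℝ) : ℂ) •
      (leftTranslation H p.1 * Psi α (π.toFun (entry x p.1 p.2)) * leftTranslation H p.2⁻¹) := by
  rw [sigmaTerm_apply, leftTranslation_mul, leftTranslation_mul_Psi α p.1, mul_assoc, mul_assoc,
    leftTranslation_mul_Psi α p.2⁻¹, ← action_mul_apply, inv_mul_cancel, ← mul_assoc,
    leftTranslation_mul_Psi α p.1]
  simp [mul_assoc]

theorem norm_sigmaTerm_le (hk : IsWeight k) (p : G × G)
    (x : HilbertL2 G H →L[ℂ] HilbertL2 G H) :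
    ‖sigmaTerm α π k p x‖ ≤ k p.1 * k p.2 * ‖x‖ := by
  have h0 : 0 ≤ k p.1 * k p.2 := mul_nonneg (hk.pos _).le (hk.pos _).le
  rw [sigmaTerm_apply, norm_smul, Complex.norm_real, Real.norm_of_nonneg h0]
  refine mul_le_mul_of_nonneg_left ?_ h0
  calc _ ≤ ‖leftTranslation H (p.1 * p.2⁻¹)‖ *
        ‖Psi α (α p.2 (π.toFun (entry x p.1 p.2)))‖ := norm_mul_le _ _
    _ ≤ 1 * ‖x‖ := mul_le_mul (norm_leftTranslation_le _)
        ((norm_Psi_le α _).trans ((norm_action_le α _ _).trans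
          ((π.norm_toFun_le _).trans (norm_entry_le x _ _)))) (norm_nonneg _) zero_le_one
    _ = ‖x‖ := one_mul _

theorem summable_sigmaTerm (hk : IsWeight k) (x : HilbertL2 G H →L[ℂ] HilbertL2 G H) :
    Summable fun p => sigmaTerm α π k p x := by
  have h : Summable fun p : G × G => k p.1 * k p.2 :=
    hk.summable.mul_of_nonneg hk.summable (fun g => (hk.pos g).le) fun g => (hk.pos g).le
  exact Summable.of_norm_bounded (h.mul_right ‖x‖) fun p => norm_sigmaTerm_le α π hk p x

/-- The finite partial sums of `σ_ξ` are completely positive. -/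
theorem isPosForm_sum_sigmaTerm {ι : Type*} [Fintype ι]
    {M : ι → ι → HilbertL2 G H →L[ℂ] HilbertL2 G H} (hM : IsPosForm M) (F : Finset G) :
    IsPosForm fun i j => ∑ p ∈ F ×ˢ F, sigmaTerm α π k p (M i j) := by
  intro v
  have hcl : IsClosed (R.toStarSubalgebra : Set (H →L[ℂ] H)) := by
    have h := Set.isClosed_centralizer (Set.centralizer (R : Set (H →L[ℂ] H)))
    rwa [VonNeumannAlgebra.centralizer_centralizer] at h
  -- Apply `π` to the block matrix, pass from `R ⊆ B(H)` to the representation `Ψ`, and evaluate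
  -- the form at the vectors `k_g L_g* v_i`.
  have h1 : IsPosForm fun i j : ι × F =>
      R.toStarSubalgebra.subtype (π.toFun (entry (M i.1 j.1) i.2 j.2)) :=
    (hM.entry F).map_completelyPositive π.toCP
  have h2 := h1.map_of_injective Subtype.coe_injective (PsiHom α)
    fun i => (k i.2 : ℂ) • leftTranslation H (i.2 : G)⁻¹ (v i.1)
  simp only [Fintype.sum_prod_type] at h2
  convert h2 using 2 with i
  rw [Finset.sum_comm]
  refine Finset.sum_congr rfl fun j _ => ?_
  dsimp only
  rw [Finset.sum_product, sum_apply, inner_sum, ← Finset.sum_coe_sort F]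
  refine Finset.sum_congr rfl fun g _ => ?_
  rw [sum_apply, inner_sum, ← Finset.sum_coe_sort F]
  refine Finset.sum_congr rfl fun h _ => ?_
  rw [sigmaTerm_eq_conj]
  simp only [smul_apply, mul_apply_eq_comp, map_smul, inner_smul_left, inner_smul_right,
    inner_leftTranslation, PsiHom_apply, Complex.conj_ofReal, Complex.ofReal_mul]
  ring

/-- The completely positive map `σ_ξ`. Since the weight is summable, the defining series converges
absolutely in norm. -/
def sigma (hk : IsWeight k) :
    (HilbertL2 G H →L[ℂ] HilbertL2 G H) →CP (HilbertL2 G H →L[ℂ] HilbertL2 G H) where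
  toFun x := ∑' p, sigmaTerm α π k p x
  map_add' x y := by
    simp only [map_add]
    exact (summable_sigmaTerm α π hk x).tsum_add (summable_sigmaTerm α π hk y)
  map_smul' c x := by
    simp only [map_smul]
    exact (summable_sigmaTerm α π hk x).tsum_const_smul c
  map_cstarMatrix_nonneg' n M hM := by
    rw [cstarMatrix_nonneg_iff_isPosForm] at hM ⊢
    intro v
    -- The squares `F × F` are cofinal among the finite subsets of `G × G`.
    refine ge_of_tendsto' (x := Filter.atTop) (f := fun F : Finset G =>
      ∑ i, ∑ j, ⟪v i, (∑ p ∈ F ×ˢ F, sigmaTerm α π k p (M i j)) (v j)⟫_ℂ) ?_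
      fun F => isPosForm_sum_sigmaTerm α π hM F v
    refine tendsto_finsetSum _ fun i _ => tendsto_finsetSum _ fun j _ => ?_
    have h : Filter.Tendsto (fun F : Finset G => ∑ p ∈ F ×ˢ F, sigmaTerm α π k p (M i j))
        Filter.atTop (nhds (∑' p, sigmaTerm α π k p (M i j))) :=
      Filter.Tendsto.comp (g := fun s : Finset (G × G) => ∑ p ∈ s, sigmaTerm α π k p (M i j))
        (by simpa only [HasSum, SummationFilter.unconditional_filter] using
          (summable_sigmaTerm α π hk (M i j)).hasSum)
        (Filter.tendsto_finsetProd_atTop.comp Filter.tendsto_atTop_diagonal)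
    exact tendsto_const_nhds.inner
      (((ContinuousLinearMap.apply ℂ (HilbertL2 G H) (v j)).continuous.tendsto _).comp h)

theorem hasSum_sigma (hk : IsWeight k) (x : HilbertL2 G H →L[ℂ] HilbertL2 G H) :
    HasSum (fun p => sigmaTerm α π k p x) (sigma α π hk x) :=
  (summable_sigmaTerm α π hk x).hasSum

end Sigma

/-! ### The positive definite function of a weight -/

section Chi

variable {G : Type*} {k : G → ℝ}

/-- The vector of `ℓ²(G)` with the coefficients `k_g`. -/
def weightVector (hk : IsWeight k) : HilbertL2 G ℂ :=
  ⟨fun g => (k g : ℂ), memℓp_gen (by simpa using hk.hasSum_sq.summable)⟩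

@[simp]
theorem weightVector_apply (hk : IsWeight k) (g : G) : weightVector hk g = k g := rfl

variable [Group G]

/-- The coefficient function `χ(g) = ⟨λ_g ξ, ξ⟩` of the vector `ξ = (k_g)`. -/
def chi (k : G → ℝ) (g : G) : ℝ := ∑' h, k (g * h) * k h

theorem hasSum_chi (hk : IsWeight k) (g : G) : HasSum (fun h => k (g * h) * k h) (chi k g) := by
  refine Summable.hasSum ?_
  refine (hk.summable.mul_left (∑' h, k h)).of_nonneg_of_le
    (fun _ => mul_nonneg (hk.pos _).le (hk.pos _).le) fun _ => ?_
  exact mul_le_mul_of_nonneg_right (hk.summable.le_tsum _ fun i _ => (hk.pos i).le) (hk.pos _).le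

theorem chi_pos (hk : IsWeight k) (g : G) : 0 < chi k g :=
  (hasSum_chi hk g).summable.tsum_pos (fun _ => mul_nonneg (hk.pos _).le (hk.pos _).le) 1
    (mul_pos (hk.pos _) (hk.pos _))

theorem chi_one (hk : IsWeight k) : chi k 1 = 1 :=
  (hasSum_chi hk 1).unique (by simpa [sq] using hk.hasSum_sq)

theorem inner_weightVector (hk : IsWeight k) (g : G) :
    ⟪weightVector hk, leftTranslation ℂ g (weightVector hk)⟫_ℂ = chi k g := by
  refine (lp.hasSum_inner _ _).unique ?_
  rw [← (Equiv.mulLeft g).hasSum_iff]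
  have h : (fun i => ⟪weightVector hk i, leftTranslation ℂ g (weightVector hk) i⟫_ℂ) ∘
      Equiv.mulLeft g = fun h => ((k (g * h) * k h : ℝ) : ℂ) := by
    ext h
    simp [mul_comm]
  rw [h]
  exact Complex.hasSum_ofReal.2 (hasSum_chi hk g)

theorem norm_weightVector (hk : IsWeight k) : ‖weightVector hk‖ = 1 := by
  have h := inner_weightVector hk 1
  rw [leftTranslation_one, chi_one hk, one_apply_eq_self, inner_self_eq_norm_sq_to_K] at h
  have h2 : ‖weightVector hk‖ ^ 2 = 1 := Complex.ofReal_injective (by simpa using h)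
  exact (pow_eq_one_iff_of_nonneg (norm_nonneg _) two_ne_zero).1 h2

theorem isPositiveDefinite_chi (hk : IsWeight k) : IsPositiveDefinite fun g => (chi k g : ℂ) := by
  intro n g
  have h : (Matrix.of fun i j => (chi k ((g i)⁻¹ * g j) : ℂ)) =
      Matrix.gram ℂ fun i => leftTranslation ℂ (g i) (weightVector hk) := by
    ext i j
    rw [Matrix.gram_apply, Matrix.of_apply, ← inner_weightVector hk, leftTranslation_mul,
      mul_apply_eq_comp, inner_leftTranslation, inv_inv]
  exact h ▸ Matrix.posSemidef_gram ℂ _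

/-- The parametrisation `h ↦ (g h, h)` of the pairs `(a, b)` with `a b⁻¹ = g`, the indices of the
block entries of an operator `L_g Ψ(r)` that can be nonzero. -/
def diagonalPair (g h : G) : G × G := (g * h, h)

theorem diagonalPair_injective (g : G) : Function.Injective (diagonalPair g) :=
  fun _ _ h => congrArg Prod.snd h

theorem ne_of_notMem_range_diagonalPair {g : G} {p : G × G} (hp : p ∉ Set.range (diagonalPair g)) :
    p.1 ≠ g * p.2 := fun h => hp ⟨p.2, Prod.ext h.symm rfl⟩

end Chi

/-! ### The pair `(χ, σ_ξ)` is an unbounded expectation -/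

section Expectation

variable {H : Type*} [NormedAddCommGroup H] [InnerProductSpace ℂ H] [CompleteSpace H]
  {G : Type*} [Group G] {R : VonNeumannAlgebra H} (α : Action G R) (π : ConditionalExpectation R)
  {k : G → ℝ} (hk : IsWeight k)

theorem sigma_mem_crossedProduct (x : HilbertL2 G H →L[ℂ] HilbertL2 G H) :
    sigma α π hk x ∈ crossedProduct α :=
  mem_crossedProduct_of_hasSum α (hasSum_sigma α π hk x)

theorem sigma_leftTranslation_mul_Psi (g : G) (r : R.toStarSubalgebra) :
    sigma α π hk (leftTranslation H g * Psi α r) =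
      (chi k g : ℂ) • (leftTranslation H g * Psi α r) := by
  classical
  have h := hasSum_sigma α π hk (leftTranslation H g * Psi α r)
  rw [← (diagonalPair_injective g).hasSum_iff] at h
  · refine h.unique ?_
    convert (Complex.hasSum_ofReal.2 (hasSum_chi hk g)).smul_const
      (leftTranslation H g * Psi α r) using 2 with q
    rw [Function.comp_apply, sigmaTerm_apply, entry_leftTranslation_mul_Psi]
    simp only [diagonalPair, if_true, π.toFun_coe, ← action_mul_apply, mul_inv_cancel_right,
      mul_inv_cancel]
    simp
  · intro p hp
    rw [sigmaTerm_apply, entry_leftTranslation_mul_Psi, if_neg (ne_of_notMem_range_diagonalPair hp),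
      π.toFun_zero, map_zero, ← PsiHom_apply, map_zero, mul_zero, smul_zero]

theorem sigma_one : sigma α π hk 1 = 1 := by
  have h := sigma_leftTranslation_mul_Psi α π hk 1 1
  rwa [leftTranslation_one, ← PsiHom_apply, map_one, mul_one, chi_one hk, Complex.ofReal_one,
    one_smul] at h

theorem sigmaTerm_Psi_mul_mul_Psi (r s : R.toStarSubalgebra) (p : G × G)
    (x : HilbertL2 G H →L[ℂ] HilbertL2 G H) :
    sigmaTerm α π k p (Psi α r * x * Psi α s) = Psi α r * sigmaTerm α π k p x * Psi α s := by
  rw [sigmaTerm_apply, sigmaTerm_apply, entry_Psi_mul_mul_Psi, π.toFun_mul_mul, map_mul, map_mul,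
    ← action_mul_apply, ← action_mul_apply, mul_inv_cancel, ← PsiHom_apply α (_ * _), map_mul,
    map_mul, PsiHom_apply, PsiHom_apply, PsiHom_apply, mul_smul_comm, smul_mul_assoc, ← mul_assoc,
    ← mul_assoc, ← mul_assoc, leftTranslation_mul_Psi, ← action_mul_apply]
  simp [mul_assoc]

theorem sigma_Psi_mul_mul_Psi (r s : R.toStarSubalgebra) (x : HilbertL2 G H →L[ℂ] HilbertL2 G H) :
    sigma α π hk (Psi α r * x * Psi α s) = Psi α r * sigma α π hk x * Psi α s := by
  refine (hasSum_sigma α π hk _).unique ?_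
  simp only [sigmaTerm_Psi_mul_mul_Psi]
  exact ((hasSum_sigma α π hk x).mul_left _).mul_right _

/-- In the entry of `σ_ξ(x)` at `(g b, b)` only the summands with index `(g h, h)` contribute, so its
norm is at most `∑ k_(gh) k_h ‖x‖ = χ(g) ‖x‖`. -/
theorem norm_Diag_leftTranslation_mul_sigma_le (x : HilbertL2 G H →L[ℂ] HilbertL2 G H) (g : G) :
    ‖Diag (leftTranslation H g⁻¹ * sigma α π hk x)‖ ≤ chi k g * ‖x‖ := by
  classical
  refine norm_blockDiagonal_le _ _ (mul_nonneg (chi_pos hk g).le (norm_nonneg x)) fun b => ?_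
  rw [entry_leftTranslation_mul, inv_inv]
  have h := (hasSum_sigma α π hk x).mapL (entryCLM H (g * b) b)
  rw [← (diagonalPair_injective g).hasSum_iff] at h
  · refine h.norm_le_of_bounded ((hasSum_chi hk g).mul_right ‖x‖) fun q => ?_
    exact (norm_entry_le _ _ _).trans (norm_sigmaTerm_le α π hk _ x)
  · intro p hp
    rw [sigmaTerm_apply, map_smul, entryCLM_apply, entry_leftTranslation_mul_Psi, if_neg, smul_zero]
    intro e
    refine ne_of_notMem_range_diagonalPair hp ?_
    rw [mul_right_cancel e, inv_mul_cancel_right]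

theorem isUnboundedExpectation_sigma : IsUnboundedExpectation α (chi k) (sigma α π hk) where
  pos := chi_pos hk
  posDef := isPositiveDefinite_chi hk
  mem := sigma_mem_crossedProduct α π hk
  unital := sigma_one α π hk
  bimodular := sigma_Psi_mul_mul_Psi α π hk
  eigen := sigma_leftTranslation_mul_Psi α π hk
  norm_Diag_le := norm_Diag_leftTranslation_mul_sigma_le α π hk

theorem isSigma_sigma : IsSigma α π (weightVector hk) (sigma α π hk) := by
  intro x a b
  have h := (hasSum_sigma α π hk x).mapL (entryCLM H a b)
  simp only [sigmaTerm_apply, entryCLM_apply] at h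
  simpa using h

end Expectation

end CrossedProduct

end

open CrossedProduct in
theorem mainTheorem1 {H : Type*} [NormedAddCommGroup H] [InnerProductSpace ℂ H] [CompleteSpace H]
    (R : VonNeumannAlgebra H) (hR : IsInjective R)
    {G : Type*} [Group G] [Countable G] (α : Action G R) :
    ∃ (χ : G → ℝ)
      (σ : (HilbertL2 G H →L[ℂ] HilbertL2 G H) →CP (HilbertL2 G H →L[ℂ] HilbertL2 G H)),
      IsUnboundedExpectation α χ σ ∧
      ∃ (π : ConditionalExpectation R) (ξ : HilbertL2 G ℂ),
        ‖ξ‖ = 1 ∧ (∀ g, 0 < ξ g) ∧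
        (∀ g, (χ g : ℂ) = ⟪ξ, leftTranslation ℂ g ξ⟫_ℂ) ∧
        IsSigma α π ξ σ := by
  obtain ⟨π⟩ := exists_conditionalExpectation hR
  obtain ⟨k, hk⟩ := exists_isWeight G
  exact ⟨chi k, sigma α π hk, isUnboundedExpectation_sigma α π hk, π, weightVector hk,
    norm_weightVector hk, fun g => Complex.zero_lt_real.2 (hk.pos g),
    fun g => (inner_weightVector hk g).symm, isSigma_sigma α π hk⟩
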